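/- **Setting.** Let $\lambda>0$, $\tau\in(0,1)$, $L_0>0$, $0<\varepsilon\le 1/4$, $k^*>3/(2\varepsilon)$ and $M\in\mathbb R$. Let $(d_n)$ be a sequence of natural numbers with $d_n=o(n^{1/4-\varepsilon})$ as $n\to\infty$. For given $n,p$ with $\tau\le p/n\le 1/\tau$ consider the following. * $\ell_0:\mathbb R\to\mathbb R$ is convex and has a weak derivative $\ell_0'$, with $\max\{\ell_0(0),\operatorname{ess\,sup}|\ell_0'|\}\le L_0$ (e.g. the absolute or the Huber loss); $\theta_0\in\mathbb R^p$; $\Sigma\in\mathbb R^{p\times p}$ is positive definite. * $X_1,\dots,X_n$ are i.i.d. random vectors in $\mathbb R^p$ with $E[X_i]=0$, $E[X_iX_i^\top]=\Sigma/n$ and $\max_{j\le p}E|\sqrt n\,X_{i,j}|^{2\lceil k^*/2\rceil}\le M$. They are $d_n$-block dependent: there is a partition of $\{1,\dots,p\}$ into at most $p$ cells of size at most $d_n$ such that coordinates of $X_i$ with indices in different cells are independent. * $G_1,\dots,G_n$ are i.i.d. $N(0,\Sigma/n)$, and the noise variables $\xi_1,\dots,\xi_n$ are i.i.d., independent of $(X_i)_i$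 and independent of $(G_i)_i$. * For a design $\mathbf Z=(Z_1,\dots,Z_n)^\top$ put $$H^R(w,\mathbf Z,\xi)=\frac1n\sum_{i=1}^n\ell_0(Z_i^\top w-\xi_i)+\frac{\lambda}{2}\|w+\theta_0\|^2,\qquad w\in\mathbb R^p,$$ with the Euclidean norm, and let $\hat w^R_{\mathbf X}$ be the minimizer of $H^R(\cdot,\mathbf X,\xi)$ over $\mathbb R^p$. **Theorem.** There is a constant $K>0$, depending only on $\lambda,\tau,M,k^*,\varepsilon,L_0$, such that for every such sequence $(d_n)$ and all sufficiently large $n$ (how large depends only on the same parameters and on the sequence $(d_n)$) the following holds for all $p$, $\ell_0$, $\theta_0$, $\Sigma$, $X$, $G$, $\xi$ as above. Let $\mathcal S_n\subset\mathbb R^p$ be measurable, and suppose that $z\in\mathbb R$, $\rho_0>0$ and $\varepsilon_n\in[0,1/4)$ satisfy the gap condition $$\max\Big\{\Pr\big(\min_{w\in\mathbb R^p}H^R(w,\mathbf G,\xi)\ge z+\rho_0\big),\ \Pr\big(\min_{w\in\mathcal S_n}H^R(w,\mathbf G,\xi)\le z+2\rho_0\big)\Big\}\le\varepsilon_n ,$$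 where the minimum over $\mathcal S_n$ is read as an infimum ($+\infty$ if $\mathcal S_n=\emptyset$). Then $$\Pr(\hat w^R_{\mathbf X}\in\mathcal S_n)\le 4\varepsilon_n+K\big(1+\|\theta_0\|_\infty^{k^*}+\rho_0^{-3}\big)\,n^{-1/45}.$$ -/

import Mathlib

open MeasureTheory ProbabilityTheory Filter Asymptotics


/-- `g` is a weak derivative of `f : ℝ → ℝ`: both are locally integrable and integration by parts
holds against every smooth compactly supported test function. -/
def IsWeakDeriv (f g : ℝ → ℝ) : Prop :=
  LocallyIntegrable f volume ∧ LocallyIntegrable g volume ∧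
    ∀ φ : ℝ → ℝ, ContDiff ℝ ((⊤ : ℕ∞) : WithTop ℕ∞) φ → HasCompactSupport φ →
      ∫ x, f x * deriv φ x = -∫ x, g x * φ x

/-- A robust loss with constant `L₀`: a convex function on the real line, with value at most `L₀`
at the origin, that has a weak derivative bounded by `L₀` almost everywhere. -/
def IsRobustLoss (loss : ℝ → ℝ) (L₀ : ℝ) : Prop :=
  ConvexOn ℝ Set.univ loss ∧ loss 0 ≤ L₀ ∧
    ∃ g : ℝ → ℝ, IsWeakDeriv loss g ∧ ∀ᵐ x ∂(volume : Measure ℝ), |g x| ≤ L₀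

/-- The robust cost
`n⁻¹ ∑ i, loss (xᵢᵀ w - ξᵢ) + (lam / 2) ‖w + θ₀‖²`, where `x i` is the `i`-th row of the design
matrix and `ξ` is the noise vector. The norm is the Euclidean one. -/
noncomputable def robustCost {n p : ℕ} (loss : ℝ → ℝ) (lam : ℝ)
    (θ₀ : EuclideanSpace ℝ (Fin p)) (x : Fin n → EuclideanSpace ℝ (Fin p)) (ξ : Fin n → ℝ)
    (w : EuclideanSpace ℝ (Fin p)) : ℝ :=
  (1 / (n : ℝ)) * ∑ i, loss (inner ℝ (x i) w - ξ i) + lam / 2 * ‖w + θ₀‖ ^ 2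

/-- The minimal value (infimum) over `S` of the robust cost, as an extended real number
(`+∞` if `S` is empty). -/
noncomputable def minRobustCost {n p : ℕ} (loss : ℝ → ℝ) (lam : ℝ)
    (θ₀ : EuclideanSpace ℝ (Fin p)) (S : Set (EuclideanSpace ℝ (Fin p)))
    (x : Fin n → EuclideanSpace ℝ (Fin p)) (ξ : Fin n → ℝ) : EReal :=
  ⨅ w ∈ S, ((robustCost loss lam θ₀ x ξ w : ℝ) : EReal)

/-- `Z 0, Z 1, …` are independent and identically distributed random variables under `P`. -/
def IsIID {Ω E : Type*} [MeasurableSpace Ω] [MeasurableSpace E] {n : ℕ} (Z : Fin n → Ω → E)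
    (P : Measure Ω) : Prop :=
  (∀ i, Measurable (Z i)) ∧ iIndepFun Z P ∧ ∀ i j, IdentDistrib (Z i) (Z j) P P

/-- Block dependence of a random vector with parameter `d`: the coordinates are partitioned into
at most `p` cells of cardinality at most `d`, and two coordinates from different cells are
independent. -/
def IsBlockDependent {Ω : Type*} [MeasurableSpace Ω] {p : ℕ}
    (X : Ω → EuclideanSpace ℝ (Fin p)) (d : ℕ) (P : Measure Ω) : Prop :=
  ∃ k : ℕ, k ≤ p ∧ ∃ B : Fin k → Finset (Fin p),
    (∀ a b, a ≠ b → Disjoint (B a) (B b)) ∧ (∀ l, ∃ a, l ∈ B a) ∧ (∀ a, (B a).card ≤ d) ∧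
    ∀ a b, a ≠ b → ∀ l ∈ B a, ∀ m ∈ B b, IndepFun (fun ω => X ω l) (fun ω => X ω m) P

/-- `X` has mean zero and second moment matrix `Sig / n`. -/
def HasMoments {Ω : Type*} [MeasurableSpace Ω] {p : ℕ} (X : Ω → EuclideanSpace ℝ (Fin p))
    (n : ℕ) (Sig : Matrix (Fin p) (Fin p) ℝ) (P : Measure Ω) : Prop :=
  (∀ j, Integrable (fun ω => X ω j) P ∧ ∫ ω, X ω j ∂P = 0) ∧
    ∀ j l, Integrable (fun ω => X ω j * X ω l) P ∧ ∫ ω, X ω j * X ω l ∂P = Sig j l / n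

/-!
Fourth moments and sparsity of the covariance matrix force the Gram matrix of either design to have
Frobenius norm `o(n)` with high probability. The average loss is then Lipschitz with a small
constant `c`, and the penalty alone confines every minimizer to the ball of radius `2c / lam`
around `-θ₀`. On that ball the Gaussian cost exceeds its minimum by at most `5c² / lam`, which is
at most `ρ₀` for a suitable `c`. The gap condition therefore keeps `S` away from the ball, so that
the estimator can fall into `S` only when the Lipschitz bound fails.
-/

open scoped NNReal ENNReal

section RobustLoss

variable {f g h : ℝ → ℝ} {L₀ : ℝ}

theorem absolutelyContinuousOnInterval_of_locallyLipschitz (hf : LocallyLipschitz f) (a b : ℝ) :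
    AbsolutelyContinuousOnInterval f a b := by
  obtain ⟨K, hK⟩ := (hf.locallyLipschitzOn (s := Set.uIcc a b)
    ).exists_lipschitzOnWith_of_compact isCompact_uIcc
  exact hK.absolutelyContinuousOnInterval

theorem locallyIntegrable_deriv_of_locallyLipschitz (hf : LocallyLipschitz f) :
    LocallyIntegrable (deriv f) := by
  refine locallyIntegrable_iff.2 fun k hk => ?_
  obtain ⟨R, -, hR⟩ := hk.isBounded.subset_ball_lt 0 0
  rw [Real.ball_eq_Ioo, zero_sub, zero_add] at hR
  exact (absolutelyContinuousOnInterval_of_locallyLipschitz hf (-R) R).intervalIntegrable_deriv.1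
    |>.mono_set (hR.trans Set.Ioo_subset_Ioc_self)

theorem isWeakDeriv_deriv (hf : LocallyLipschitz f) : IsWeakDeriv f (deriv f) := by
  refine ⟨hf.continuous.locallyIntegrable, locallyIntegrable_deriv_of_locallyLipschitz hf,
    fun φ hφ hc => ?_⟩
  obtain ⟨R, -, hR⟩ := hc.isCompact.isBounded.subset_ball_lt 0 0
  rw [Real.ball_eq_Ioo, zero_sub, zero_add] at hR
  have hsupp : tsupport φ ⊆ Set.Ioc (-R) R := hR.trans Set.Ioo_subset_Ioc_self
  have hzero : ∀ x ∉ Set.Ioo (-R) R, φ x = 0 := fun x hx =>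
    image_eq_zero_of_notMem_tsupport (mt (@hR x) hx)
  have hφ' : AbsolutelyContinuousOnInterval φ (-R) R :=
    (hφ.of_le (by exact_mod_cast le_top)).contDiffOn.absolutelyContinuousOnInterval
  have hparts := (absolutelyContinuousOnInterval_of_locallyLipschitz hf (-R) R
    ).integral_mul_deriv_eq_deriv_mul hφ'
  rwa [hzero _ Set.left_notMem_Ioo, hzero _ Set.right_notMem_Ioo, mul_zero, mul_zero, sub_zero,
    zero_sub, intervalIntegral.integral_eq_integral_of_support_subset,
    intervalIntegral.integral_eq_integral_of_support_subset] at hparts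
  · exact (Function.support_mul_subset_right _ _).trans ((subset_tsupport φ).trans hsupp)
  · exact (Function.support_mul_subset_right _ _).trans
      ((subset_tsupport _).trans ((tsupport_deriv_subset).trans hsupp))

theorem IsWeakDeriv.ae_eq (hg : IsWeakDeriv f g) (hh : IsWeakDeriv f h) :
    ∀ᵐ x, g x = h x := by
  refine ae_eq_of_integral_contDiff_smul_eq hg.2.1 hh.2.1 fun φ hφ hc => ?_
  simp only [smul_eq_mul, mul_comm (φ _)]
  rw [← neg_inj, ← hg.2.2 φ hφ hc, hh.2.2 φ hφ hc]

theorem IsWeakDeriv.lipschitzWith (hf : LocallyLipschitz f) (hg : IsWeakDeriv f g)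
    (hbound : ∀ᵐ x, |g x| ≤ L₀) : LipschitzWith L₀.toNNReal f := by
  refine .of_dist_le' fun a b => ?_
  rw [dist_eq_norm, dist_eq_norm, Real.norm_eq_abs (a - b),
    ← (absolutelyContinuousOnInterval_of_locallyLipschitz hf b a).integral_deriv_eq_sub]
  refine intervalIntegral.norm_integral_le_of_norm_le_const_ae ?_
  filter_upwards [(isWeakDeriv_deriv hf).ae_eq hg, hbound] with x hderiv hx _
  rwa [hderiv]

theorem IsRobustLoss.lipschitzWith (hf : IsRobustLoss f L₀) : LipschitzWith L₀.toNNReal f := by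
  obtain ⟨hconv, -, g, hg, hbound⟩ := hf
  exact hg.lipschitzWith hconv.locallyLipschitz hbound

end RobustLoss

section Design

variable {ι E : Type*} [Fintype ι] [SeminormedAddCommGroup E] [InnerProductSpace ℝ E]

/-- The squared Frobenius norm of the Gram matrix of a family of vectors. It controls the operator
norm of the design with rows `x i`, and, being a polynomial in the entries, it is easy to
integrate. -/
noncomputable def gramSq (x : ι → E) : ℝ :=
  ∑ i, ∑ j, inner ℝ (x i) (x j) ^ 2

theorem gramSq_nonneg (x : ι → E) : 0 ≤ gramSq x := by
  unfold gramSq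
  positivity

theorem norm_sum_smul_sq_le (x : ι → E) (a : ι → ℝ) :
    ‖∑ i, a i • x i‖ ^ 2 ≤ (∑ i, a i ^ 2) * √(gramSq x) := by
  have hnorm : ‖∑ i, a i • x i‖ ^ 2 =
      ∑ q : ι × ι, a q.1 * a q.2 * inner ℝ (x q.1) (x q.2) := by
    rw [← real_inner_self_eq_norm_sq, sum_inner]
    simp only [inner_sum, real_inner_smul_left, real_inner_smul_right, Fintype.sum_prod_type]
    exact Finset.sum_congr rfl fun i _ => Finset.sum_congr rfl fun j _ => by ring
  have hcoeff : √(∑ q : ι × ι, (a q.1 * a q.2) ^ 2) = ∑ i, a i ^ 2 := by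
    simp only [mul_pow, Fintype.sum_prod_type, ← Finset.sum_mul_sum]
    exact Real.sqrt_mul_self (by positivity)
  have hgram : gramSq x = ∑ q : ι × ι, inner ℝ (x q.1) (x q.2) ^ 2 := by
    rw [gramSq, Fintype.sum_prod_type]
  rw [hnorm, ← hcoeff, hgram]
  exact Real.sum_mul_le_sqrt_mul_sqrt _ _ _

theorem sum_inner_sq_le (x : ι → E) (w : E) :
    ∑ i, inner ℝ (x i) w ^ 2 ≤ √(gramSq x) * ‖w‖ ^ 2 := by
  set s := ∑ i, inner ℝ (x i) w ^ 2 with hs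
  set u := ∑ i, (inner ℝ (x i) w : ℝ) • x i with hu
  have hs₀ : 0 ≤ s := by positivity
  have hsu : s = inner ℝ u w := by
    simp only [hs, hu, sum_inner, real_inner_smul_left, sq]
  have hsq : s * s ≤ s * (√(gramSq x) * ‖w‖ ^ 2) := by
    calc s * s ≤ (‖u‖ * ‖w‖) * (‖u‖ * ‖w‖) := by
          have := hsu.trans_le (real_inner_le_norm u w)
          gcongr
      _ = ‖u‖ ^ 2 * ‖w‖ ^ 2 := by ring
      _ ≤ s * √(gramSq x) * ‖w‖ ^ 2 := by
          gcongr
          exact norm_sum_smul_sq_le x _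
      _ = s * (√(gramSq x) * ‖w‖ ^ 2) := by ring
  rcases hs₀.eq_or_lt with h₀ | h₀
  · rw [← h₀]
    positivity
  · exact le_of_mul_le_mul_left hsq h₀

theorem sum_abs_inner_sq_le (x : ι → E) (w : E) :
    (∑ i, |inner ℝ (x i) w|) ^ 2 ≤ Fintype.card ι * (√(gramSq x) * ‖w‖ ^ 2) := by
  calc (∑ i, |inner ℝ (x i) w|) ^ 2 ≤ Fintype.card ι * ∑ i, |inner ℝ (x i) w| ^ 2 :=
        sq_sum_le_card_mul_sum_sq
    _ ≤ Fintype.card ι * (√(gramSq x) * ‖w‖ ^ 2) := by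
        simp only [sq_abs]
        gcongr
        exact sum_inner_sq_le x w

/-- The average loss of the residuals `⟪x i, w⟫ - ξ i`, that is, `robustCost` without its
penalty. -/
noncomputable def meanLoss {n : ℕ} (loss : ℝ → ℝ) (x : Fin n → E) (ξ : Fin n → ℝ) (w : E) : ℝ :=
  (1 / (n : ℝ)) * ∑ i, loss (inner ℝ (x i) w - ξ i)

theorem lipschitzWith_meanLoss {n : ℕ} {loss : ℝ → ℝ} {L c : ℝ≥0} (hloss : LipschitzWith L loss)
    {x : Fin n → E} (hx : (L : ℝ) ^ 2 * √(gramSq x) ≤ n * (c : ℝ) ^ 2) (ξ : Fin n → ℝ) :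
    LipschitzWith c (meanLoss loss x ξ) := by
  refine .of_dist_le_mul fun w v => ?_
  have hterm : ∀ i, |loss (inner ℝ (x i) w - ξ i) - loss (inner ℝ (x i) v - ξ i)| ≤
      L * |inner ℝ (x i) (w - v)| := fun i => by
    simpa only [Real.dist_eq, sub_sub_sub_cancel_right, ← inner_sub_right] using
      hloss.dist_le_mul (inner ℝ (x i) w - ξ i) (inner ℝ (x i) v - ξ i)
  have hsum : L * ∑ i, |inner ℝ (x i) (w - v)| ≤ n * (c * ‖w - v‖) := by
    refine le_of_sq_le_sq ?_ (by positivity)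
    calc (L * ∑ i, |inner ℝ (x i) (w - v)|) ^ 2
        = L ^ 2 * (∑ i, |inner ℝ (x i) (w - v)|) ^ 2 := mul_pow _ _ _
      _ ≤ L ^ 2 * (n * (√(gramSq x) * ‖w - v‖ ^ 2)) := by
          gcongr
          simpa only [Fintype.card_fin] using sum_abs_inner_sq_le x (w - v)
      _ = n * (L ^ 2 * √(gramSq x)) * ‖w - v‖ ^ 2 := by ring
      _ ≤ n * (n * c ^ 2) * ‖w - v‖ ^ 2 := by gcongr
      _ = (n * (c * ‖w - v‖)) ^ 2 := by ring
  rw [Real.dist_eq, dist_eq_norm, meanLoss, meanLoss, ← mul_sub, ← Finset.sum_sub_distrib,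
    abs_mul, abs_of_nonneg (by positivity), one_div]
  refine inv_mul_le_of_le_mul₀ (by positivity) (by positivity) ?_
  calc |∑ i, (loss (inner ℝ (x i) w - ξ i) - loss (inner ℝ (x i) v - ξ i))|
      ≤ ∑ i, L * |inner ℝ (x i) (w - v)| :=
        (Finset.abs_sum_le_sum_abs _ _).trans (Finset.sum_le_sum fun i _ => hterm i)
    _ = L * ∑ i, |inner ℝ (x i) (w - v)| := (Finset.mul_sum _ _ _).symm
    _ ≤ n * (c * ‖w - v‖) := hsum

end Design

section Penalty

variable {E : Type*} [SeminormedAddCommGroup E] {f : E → ℝ} {c : ℝ≥0} {lam : ℝ} {θ v w : E}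

theorem norm_add_le_of_penalized_le (hf : LipschitzWith c f)
    (hw : f w + lam / 2 * ‖w + θ‖ ^ 2 ≤ f (-θ)) : lam * ‖w + θ‖ ≤ 2 * c := by
  have hdist : f (-θ) - f w ≤ c * ‖w + θ‖ := by
    have h := (le_abs_self _).trans (hf.dist_le_mul (-θ) w)
    rwa [dist_comm, dist_eq_norm, sub_neg_eq_add] at h
  rcases (norm_nonneg (w + θ)).eq_or_lt with h₀ | h₀
  · rw [← h₀, mul_zero]
    positivity
  · refine le_of_mul_le_mul_right ?_ h₀
    linarith

theorem penalized_sub_le (hf : LipschitzWith c f) (hlam : 0 ≤ lam)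
    (hw : lam * ‖w + θ‖ ≤ 2 * c) :
    lam * ((f w + lam / 2 * ‖w + θ‖ ^ 2) - (f v + lam / 2 * ‖v + θ‖ ^ 2)) ≤ 5 * (c : ℝ) ^ 2 := by
  set s := ‖w + θ‖
  set t := ‖v + θ‖
  have hdist : f w - f v ≤ c * (s + t) := by
    refine (le_abs_self _).trans ((hf.dist_le_mul w v).trans ?_)
    gcongr
    rw [dist_eq_norm, ← add_sub_add_right_eq_sub w v θ]
    exact norm_sub_le _ _
  have hs : (lam * s) ^ 2 ≤ (2 * c) ^ 2 := by gcongr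
  have hcs : c * (lam * s) ≤ c * (2 * c) := by gcongr
  calc lam * ((f w + lam / 2 * s ^ 2) - (f v + lam / 2 * t ^ 2))
      ≤ lam * (c * (s + t) + lam / 2 * s ^ 2 - lam / 2 * t ^ 2) :=
        mul_le_mul_of_nonneg_left (by linarith) hlam
    _ = c * (lam * s) + (lam * s) ^ 2 / 2 + (c ^ 2 - (lam * t - c) ^ 2) / 2 := by ring
    _ ≤ 5 * c ^ 2 := by nlinarith [sq_nonneg (lam * t - c)]

end Penalty

section Moments

variable {Ω : Type*} [MeasurableSpace Ω] {P : Measure Ω}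

theorem memLp_two_mul_of_memLp_four {f g : Ω → ℝ} (hf : MemLp f 4 P) (hg : MemLp g 4 P) :
    MemLp (fun ω => f ω * g ω) 2 P := by
  have : ENNReal.HolderTriple 4 4 2 := ⟨by
    rw [show (4 : ℝ≥0∞) = 2 * 2 by norm_num, ENNReal.mul_inv (by norm_num) (by norm_num),
      ← two_mul, ← mul_assoc, ENNReal.mul_inv_cancel (by norm_num) (by norm_num), one_mul]⟩
  exact hg.mul hf

theorem memLp_two_inner_of_memLp_four {E : Type*} [NormedAddCommGroup E] [InnerProductSpace ℝ E]
    {Y Z : Ω → E} (hY : MemLp Y 4 P) (hZ : MemLp Z 4 P) :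
    MemLp (fun ω => (inner ℝ (Y ω) (Z ω) : ℝ)) 2 P :=
  (memLp_two_mul_of_memLp_four hY.norm hZ.norm).mono (hY.1.inner hZ.1) <| .of_forall fun ω => by
    simpa only [norm_mul, norm_norm] using norm_inner_le_norm (𝕜 := ℝ) (Y ω) (Z ω)

theorem integrable_pow_four {f : Ω → ℝ} (hf : MemLp f 4 P) : Integrable (fun ω => f ω ^ 4) P := by
  simpa only [Real.norm_eq_abs, Even.pow_abs (by decide : Even 4)] using
    hf.integrable_norm_pow (p := 4) (by norm_num)

theorem sq_integral_mul_le [IsProbabilityMeasure P] {f g : Ω → ℝ} (hf : MemLp f 4 P)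
    (hg : MemLp g 4 P) :
    (∫ ω, f ω * g ω ∂P) ^ 2 ≤ (∫ ω, f ω ^ 4 ∂P + ∫ ω, g ω ^ 4 ∂P) / 2 := by
  have hfg := memLp_two_mul_of_memLp_four hf hg
  have hf₄ := integrable_pow_four hf
  have hg₄ := integrable_pow_four hg
  have hjensen := variance_nonneg (fun ω => f ω * g ω) P
  rw [variance_eq_sub hfg] at hjensen
  calc (∫ ω, f ω * g ω ∂P) ^ 2 ≤ ∫ ω, (f ω * g ω) ^ 2 ∂P := sub_nonneg.1 hjensen
    _ ≤ ∫ ω, (f ω ^ 4 + g ω ^ 4) / 2 ∂P :=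
        integral_mono hfg.integrable_sq ((hf₄.add hg₄).div_const 2) fun ω => by
          linarith [two_mul_le_add_sq (f ω ^ 2) (g ω ^ 2), mul_pow (f ω) (g ω) 2]
    _ = (∫ ω, f ω ^ 4 ∂P + ∫ ω, g ω ^ 4 ∂P) / 2 := by
        rw [integral_div, integral_add hf₄ hg₄]

variable {ι κ : Type*} [Fintype ι] [Fintype κ]

theorem integral_inner_sq_of_indepFun {Y Z : Ω → EuclideanSpace ℝ κ} (hYZ : IndepFun Y Z P)
    (hY : ∀ j, MemLp (fun ω => Y ω j) 2 P) (hZ : ∀ j, MemLp (fun ω => Z ω j) 2 P) :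
    ∫ ω, inner ℝ (Y ω) (Z ω) ^ 2 ∂P =
      ∑ j, ∑ l, (∫ ω, Y ω j * Y ω l ∂P) * ∫ ω, Z ω j * Z ω l ∂P := by
  have hexp : ∀ ω, inner ℝ (Y ω) (Z ω) ^ 2 =
      ∑ j, ∑ l, (Y ω j * Y ω l) * (Z ω j * Z ω l) := fun ω => by
    rw [PiLp.inner_apply, sq, Finset.sum_mul_sum]
    refine Finset.sum_congr rfl fun j _ => Finset.sum_congr rfl fun l _ => ?_
    simp only [Real.inner_apply]
    ring
  have hind : ∀ j l, IndepFun (fun ω => Y ω j * Y ω l) (fun ω => Z ω j * Z ω l) P := fun j l =>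
    hYZ.comp (φ := fun y : EuclideanSpace ℝ κ => y j * y l)
      (ψ := fun y : EuclideanSpace ℝ κ => y j * y l) (by fun_prop) (by fun_prop)
  have hYint : ∀ j l, Integrable (fun ω => Y ω j * Y ω l) P := fun j l =>
    (hY j).integrable_mul (hY l)
  have hZint : ∀ j l, Integrable (fun ω => Z ω j * Z ω l) P := fun j l =>
    (hZ j).integrable_mul (hZ l)
  have hint : ∀ j l, Integrable (fun ω => (Y ω j * Y ω l) * (Z ω j * Z ω l)) P := fun j l =>
    (hind j l).integrable_mul (hYint j l) (hZint j l)
  simp only [hexp]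
  rw [integral_finsetSum _ fun j _ => integrable_finsetSum _ fun l _ => hint j l]
  refine Finset.sum_congr rfl fun j _ => ?_
  rw [integral_finsetSum _ fun l _ => hint j l]
  exact Finset.sum_congr rfl fun l _ =>
    (hind j l).integral_fun_mul_eq_mul_integral (hYint j l).1 (hZint j l).1

/-- `Y` is a random vector in `L⁴` whose matrix of second moments is `T` and whose coordinates have
fourth moments at most `c`. This is all that is used about the two designs, so that the Gaussian
one enters the argument on the same footing as the other. -/
structure HasSecondFourthMoments (Y : Ω → EuclideanSpace ℝ κ) (T : Matrix κ κ ℝ) (c : ℝ)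
    (P : Measure Ω) : Prop where
  memLp : MemLp Y 4 P
  integral_mul : ∀ j l, ∫ ω, Y ω j * Y ω l ∂P = T j l
  integral_pow_four_le : ∀ j, ∫ ω, Y ω j ^ 4 ∂P ≤ c

namespace HasSecondFourthMoments

variable {Y : Ω → EuclideanSpace ℝ κ} {T : Matrix κ κ ℝ} {c : ℝ}

theorem memLp_coord (hY : HasSecondFourthMoments Y T c P) (j : κ) :
    MemLp (fun ω => Y ω j) 4 P :=
  memLp_piLp_iff.1 hY.memLp j

theorem mono {c' : ℝ} (hY : HasSecondFourthMoments Y T c P) (h : c ≤ c') :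
    HasSecondFourthMoments Y T c' P :=
  ⟨hY.memLp, hY.integral_mul, fun j => (hY.integral_pow_four_le j).trans h⟩

theorem sq_apply_le [IsProbabilityMeasure P] (hY : HasSecondFourthMoments Y T c P) (j l : κ) :
    T j l ^ 2 ≤ c := by
  rw [← hY.integral_mul]
  linarith [sq_integral_mul_le (hY.memLp_coord j) (hY.memLp_coord l), hY.integral_pow_four_le j,
    hY.integral_pow_four_le l]

theorem sum_sq_apply_le [IsProbabilityMeasure P] (hY : HasSecondFourthMoments Y T c P) {d : ℕ}
    (hT : ∀ j, {l | T j l ≠ 0}.ncard ≤ d) : ∑ j, ∑ l, T j l ^ 2 ≤ Fintype.card κ * (d * c) := by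
  classical
  have hrow : ∀ j, ∑ l, T j l ^ 2 ≤ d * c := fun j => by
    calc ∑ l, T j l ^ 2 = ∑ l with T j l ≠ 0, T j l ^ 2 :=
          (Finset.sum_filter_of_ne fun l _ hl => by simpa using hl).symm
      _ ≤ ∑ l with T j l ≠ 0, c := Finset.sum_le_sum fun l _ => hY.sq_apply_le j l
      _ ≤ d * c := by
          rw [Finset.sum_const, nsmul_eq_mul]
          have hcard := hT j
          rw [Set.ncard_eq_toFinset_card', Set.toFinset_ofPred] at hcard
          have hc : 0 ≤ c := (sq_nonneg _).trans (hY.sq_apply_le j j)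
          gcongr
  calc ∑ j, ∑ l, T j l ^ 2 ≤ ∑ _j : κ, d * c := Finset.sum_le_sum fun j _ => hrow j
    _ = Fintype.card κ * (d * c) := by rw [Finset.sum_const, nsmul_eq_mul, Finset.card_univ]

theorem integral_inner_self_sq_le (hY : HasSecondFourthMoments Y T c P) :
    ∫ ω, inner ℝ (Y ω) (Y ω) ^ 2 ∂P ≤ (Fintype.card κ : ℝ) ^ 2 * c := by
  have hle : ∀ ω, inner ℝ (Y ω) (Y ω) ^ 2 ≤ Fintype.card κ * ∑ j, Y ω j ^ 4 := fun ω => by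
    have h := sq_sum_le_card_mul_sum_sq (s := Finset.univ) (f := fun j => Y ω j ^ 2)
    simp only [Finset.card_univ, ← pow_mul] at h
    rwa [real_inner_self_eq_norm_sq, EuclideanSpace.real_norm_sq_eq]
  have hint : ∀ j, Integrable (fun ω => Y ω j ^ 4) P := fun j =>
    integrable_pow_four (hY.memLp_coord j)
  calc ∫ ω, inner ℝ (Y ω) (Y ω) ^ 2 ∂P ≤ ∫ ω, Fintype.card κ * ∑ j, Y ω j ^ 4 ∂P :=
        integral_mono (memLp_two_inner_of_memLp_four hY.memLp hY.memLp).integrable_sq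
          ((integrable_finsetSum _ fun j _ => hint j).const_mul _) hle
    _ = Fintype.card κ * ∑ j, ∫ ω, Y ω j ^ 4 ∂P := by
        rw [integral_const_mul, integral_finsetSum _ fun j _ => hint j]
    _ ≤ Fintype.card κ * ∑ _j : κ, c := by
        gcongr with j
        exact hY.integral_pow_four_le j
    _ = (Fintype.card κ : ℝ) ^ 2 * c := by
        rw [Finset.sum_const, nsmul_eq_mul, Finset.card_univ]
        ring

end HasSecondFourthMoments

theorem integrable_gramSq {E : Type*} [NormedAddCommGroup E] [InnerProductSpace ℝ E]
    {Z : ι → Ω → E} (hZ : ∀ i, MemLp (Z i) 4 P) :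
    Integrable (fun ω => gramSq fun i => Z i ω) P :=
  integrable_finsetSum _ fun i _ => integrable_finsetSum _ fun i' _ =>
    (memLp_two_inner_of_memLp_four (hZ i) (hZ i')).integrable_sq

theorem integral_gramSq_le [IsProbabilityMeasure P] {Z : ι → Ω → EuclideanSpace ℝ κ}
    {T : Matrix κ κ ℝ} {c : ℝ} (hind : iIndepFun Z P)
    (hZ : ∀ i, HasSecondFourthMoments (Z i) T c P) :
    ∫ ω, gramSq (fun i => Z i ω) ∂P ≤
      (Fintype.card ι : ℝ) ^ 2 * ∑ j, ∑ l, T j l ^ 2 +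
        Fintype.card ι * ((Fintype.card κ : ℝ) ^ 2 * c) := by
  classical
  have hint : ∀ i i', Integrable (fun ω => inner ℝ (Z i ω) (Z i' ω) ^ 2) P := fun i i' =>
    (memLp_two_inner_of_memLp_four (hZ i).memLp (hZ i').memLp).integrable_sq
  have hterm : ∀ i i', ∫ ω, inner ℝ (Z i ω) (Z i' ω) ^ 2 ∂P ≤
      ∑ j, ∑ l, T j l ^ 2 + if i = i' then (Fintype.card κ : ℝ) ^ 2 * c else 0 := fun i i' => by
    split_ifs with h
    · subst h
      exact (hZ i).integral_inner_self_sq_le.trans (le_add_of_nonneg_left (by positivity))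
    · have hmemLp : ∀ i j, MemLp (fun ω => Z i ω j) 2 P := fun i j =>
        ((hZ i).memLp_coord j).mono_exponent (by norm_num)
      rw [integral_inner_sq_of_indepFun (hind.indepFun h) (hmemLp i) (hmemLp i')]
      simp only [(hZ _).integral_mul, sq, add_zero, le_refl]
  simp only [gramSq]
  rw [integral_finsetSum _ fun i _ => integrable_finsetSum _ fun i' _ => hint i i']
  calc ∑ i, ∫ ω, ∑ i', inner ℝ (Z i ω) (Z i' ω) ^ 2 ∂P
      = ∑ i, ∑ i', ∫ ω, inner ℝ (Z i ω) (Z i' ω) ^ 2 ∂P :=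
        Finset.sum_congr rfl fun i _ => integral_finsetSum _ fun i' _ => hint i i'
    _ ≤ ∑ i : ι, ∑ i' : ι,
          (∑ j, ∑ l, T j l ^ 2 + if i = i' then (Fintype.card κ : ℝ) ^ 2 * c else 0) :=
        Finset.sum_le_sum fun i _ => Finset.sum_le_sum fun i' _ => hterm i i'
    _ = (Fintype.card ι : ℝ) ^ 2 * ∑ j, ∑ l, T j l ^ 2 +
          Fintype.card ι * ((Fintype.card κ : ℝ) ^ 2 * c) := by
        simp only [Finset.sum_add_distrib, Finset.sum_const, Finset.card_univ, nsmul_eq_mul,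
          Finset.sum_ite_eq, Finset.mem_univ, if_true]
        ring

end Moments

section MomentConditions

variable {Ω : Type*} [MeasurableSpace Ω] {P : Measure Ω}

open Polynomial in
theorem deriv_eval_mul_exp (v : ℝ) (q : ℝ[X]) :
    deriv (fun t => q.eval t * Real.exp (v * t ^ 2 / 2)) =
      fun t => (derivative q + C v * X * q).eval t * Real.exp (v * t ^ 2 / 2) := by
  ext t
  have hexp : HasDerivAt (fun t => v * t ^ 2 / 2) (v * t) t := by
    convert! ((hasDerivAt_pow 2 t).const_mul v).div_const 2 using 1
    push_cast
    ring
  rw [((q.hasDerivAt t).fun_mul hexp.exp).deriv]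
  simp only [eval_add, eval_mul, eval_C, eval_X]
  ring

open Polynomial in
theorem integral_pow_four_gaussianReal (v : ℝ≥0) :
    ∫ x, x ^ 4 ∂(gaussianReal 0 v) = 3 * (v : ℝ) ^ 2 := by
  have hmgf : mgf id (gaussianReal 0 v) =
      fun t => (1 : ℝ[X]).eval t * Real.exp (v * t ^ 2 / 2) := by
    simp only [mgf_id_gaussianReal, eval_one, one_mul, zero_mul, zero_add]
  have h := iteratedDeriv_mgf_zero (X := id) (μ := gaussianReal 0 v)
    (by simp only [integrableExpSet_id_gaussianReal, interior_univ, Set.mem_univ]) 4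
  simp only [Pi.pow_apply, id] at h
  rw [← h, hmgf]
  simp only [iteratedDeriv_succ, iteratedDeriv_zero, deriv_eval_mul_exp]
  simp
  ring

theorem hasSecondFourthMoments_of_hasLaw_multivariateGaussian {κ : Type*} [Fintype κ]
    [DecidableEq κ] {Y : Ω → EuclideanSpace ℝ κ} {T : Matrix κ κ ℝ} {c : ℝ} (hT : T.PosSemidef)
    (hY : HasLaw Y (multivariateGaussian 0 T) P) (hc : ∀ j, 3 * T j j ^ 2 ≤ c) :
    HasSecondFourthMoments Y T c P := by
  have := hY.isProbabilityMeasure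
  have hmemLp : MemLp Y 4 P := by
    have h := IsGaussian.memLp_id (multivariateGaussian 0 T) 4 (by norm_num)
    rw [← hY.map_eq] at h
    exact (memLp_map_measure_iff aestronglyMeasurable_id hY.aemeasurable).1 h
  have hcoord : ∀ j, HasLaw (fun ω => Y ω j) (gaussianReal 0 (T j j).toNNReal) P := fun j => by
    simpa only [PiLp.zero_apply] using
      (measurePreserving_eval_multivariateGaussian (μ := 0) hT (i := j)).fun_comp_hasLaw hY
  refine ⟨hmemLp, fun j l => ?_, fun j => ?_⟩
  · have hmean : ∀ i, ∫ ω, Y ω i ∂P = 0 := fun i =>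
      (hcoord i).integral_eq.trans integral_id_gaussianReal
    have hmemLp₂ : ∀ i, MemLp (fun ω => Y ω i) 2 P := fun i =>
      (memLp_piLp_iff.1 hmemLp i).mono_exponent (by norm_num)
    have hcov : cov[fun ω => Y ω j, fun ω => Y ω l; P] = T j l :=
      (hY.covariance_comp (f := fun x => x j) (g := fun x => x l) (by fun_prop)
        (by fun_prop)).trans (covariance_eval_multivariateGaussian hT j l)
    rwa [covariance_eq_sub (hmemLp₂ j) (hmemLp₂ l), hmean, zero_mul, sub_zero] at hcov
  · calc ∫ ω, Y ω j ^ 4 ∂P = ∫ x, x ^ 4 ∂(gaussianReal 0 (T j j).toNNReal) :=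
          (hcoord j).integral_comp (f := fun x => x ^ 4) (by fun_prop)
      _ = 3 * T j j ^ 2 := by
          rw [integral_pow_four_gaussianReal, Real.coe_toNNReal _ hT.diag_nonneg]
      _ ≤ c := hc j

theorem HasSecondFourthMoments.of_hasLaw_multivariateGaussian [IsProbabilityMeasure P]
    {κ : Type*} [Fintype κ] [DecidableEq κ] {Y Z : Ω → EuclideanSpace ℝ κ} {T : Matrix κ κ ℝ}
    {c : ℝ} (hY : HasSecondFourthMoments Y T c P) (hT : T.PosSemidef)
    (hZ : HasLaw Z (multivariateGaussian 0 T) P) : HasSecondFourthMoments Z T (3 * c) P :=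
  hasSecondFourthMoments_of_hasLaw_multivariateGaussian hT hZ fun j => by
    linarith [hY.sq_apply_le j j]

theorem pow_le_one_add_pow {x : ℝ} (hx : 0 ≤ x) {a b : ℕ} (h : a ≤ b) : x ^ a ≤ 1 + x ^ b := by
  rcases le_total x 1 with h1 | h1
  · exact (pow_le_one₀ hx h1).trans (by linarith [pow_nonneg hx b])
  · exact (pow_le_pow_right₀ h1 h).trans (by linarith)

theorem memLp_four_of_integrable_abs_pow [IsFiniteMeasure P] {f : Ω → ℝ} {b : ℕ}
    (hf : AEStronglyMeasurable f P) (hb : 4 ≤ b) (hint : Integrable (fun ω => |f ω| ^ b) P) :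
    MemLp f 4 P := by
  have h : MemLp f b P := by
    rw [← integrable_norm_rpow_iff hf (by simp; omega) (by simp)]
    simpa using hint
  exact h.mono_exponent (by exact_mod_cast hb)

theorem integral_pow_four_le_one_add [IsProbabilityMeasure P] {f : Ω → ℝ} {b : ℕ}
    (hf : MemLp f 4 P) (hb : 4 ≤ b) (hint : Integrable (fun ω => |f ω| ^ b) P) :
    ∫ ω, f ω ^ 4 ∂P ≤ 1 + ∫ ω, |f ω| ^ b ∂P := by
  calc ∫ ω, f ω ^ 4 ∂P ≤ ∫ ω, (1 + |f ω| ^ b) ∂P :=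
        integral_mono (integrable_pow_four hf) ((integrable_const 1).add hint) fun ω => by
          simpa only [Even.pow_abs (by decide : Even 4)] using
            pow_le_one_add_pow (abs_nonneg (f ω)) hb
    _ = 1 + ∫ ω, |f ω| ^ b ∂P := by
        rw [integral_add (integrable_const 1) hint, integral_const, probReal_univ, one_smul]

variable {n p : ℕ} {Y : Ω → EuclideanSpace ℝ (Fin p)} {Sig : Matrix (Fin p) (Fin p) ℝ}

theorem HasMoments.hasSecondFourthMoments [IsProbabilityMeasure P] (hY : HasMoments Y n Sig P)
    (hn : 0 < n) {b : ℕ} {M : ℝ} (hb : 4 ≤ b)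
    (hM : ∀ j, Integrable (fun ω => |√(n : ℝ) * Y ω j| ^ b) P ∧
      ∫ ω, |√(n : ℝ) * Y ω j| ^ b ∂P ≤ M) :
    HasSecondFourthMoments Y ((n : ℝ)⁻¹ • Sig) ((1 + M) / n ^ 2) P := by
  have hn' : (0 : ℝ) < n := by exact_mod_cast hn
  have hscaled : ∀ j, MemLp (fun ω => √(n : ℝ) * Y ω j) 4 P := fun j =>
    memLp_four_of_integrable_abs_pow ((hY.1 j).1.1.const_mul _) hb (hM j).1
  refine ⟨memLp_piLp_iff.2 fun j => ?_, fun j l => ?_, fun j => ?_⟩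
  · have h := (hscaled j).const_mul (√(n : ℝ))⁻¹
    simpa only [inv_mul_cancel_left₀ (Real.sqrt_pos.2 hn').ne'] using h
  · rw [(hY.2 j l).2, Matrix.smul_apply, smul_eq_mul, inv_mul_eq_div]
  · have hpow : ∀ ω, (√(n : ℝ) * Y ω j) ^ 4 = (n : ℝ) ^ 2 * Y ω j ^ 4 := fun ω => by
      rw [mul_pow, show (√(n : ℝ)) ^ 4 = (√(n : ℝ) ^ 2) ^ 2 by ring, Real.sq_sqrt hn'.le]
    have h := (integral_pow_four_le_one_add (hscaled j) hb (hM j).1).trans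
      (add_le_add_right (hM j).2 1)
    simp only [hpow, integral_const_mul] at h
    rwa [le_div_iff₀' (by positivity)]

theorem IsBlockDependent.ncard_ne_zero_le {d : ℕ} (hd : IsBlockDependent Y d P)
    (hY : HasMoments Y n Sig P) (j : Fin p) : {l | ((n : ℝ)⁻¹ • Sig) j l ≠ 0}.ncard ≤ d := by
  obtain ⟨k, -, B, -, hcover, hcard, hind⟩ := hd
  obtain ⟨a, ha⟩ := hcover j
  refine le_trans ?_ (hcard a)
  rw [← Set.ncard_coe_finset]
  refine Set.ncard_le_ncard (fun l hl => ?_) (B a).finite_toSet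
  obtain ⟨b, hb⟩ := hcover l
  by_contra hla
  have hab : a ≠ b := fun h => hla (h ▸ hb)
  have hcov := (hind a b hab j ha l hb).integral_fun_mul_eq_mul_integral
    (hY.1 j).1.1 (hY.1 l).1.1
  rw [(hY.2 j l).2, (hY.1 j).2, zero_mul, ← inv_mul_eq_div] at hcov
  exact hl hcov

end MomentConditions

section Concentration

variable {Ω E : Type*} [MeasurableSpace Ω] {P : Measure Ω} [IsProbabilityMeasure P]
  [NormedAddCommGroup E] [InnerProductSpace ℝ E]

theorem measureReal_not_lipschitzWith_meanLoss_le {n : ℕ} {loss : ℝ → ℝ} {L c : ℝ≥0}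
    (hloss : LipschitzWith L loss) (hn : 0 < n) (hc : 0 < c) {Z : Fin n → Ω → E}
    (hZ : ∀ i, MemLp (Z i) 4 P) (ξ : Fin n → Ω → ℝ) :
    P.real {ω | ¬ LipschitzWith c (meanLoss loss (fun i => Z i ω) fun i => ξ i ω)} ≤
      L ^ 4 * (∫ ω, gramSq (fun i => Z i ω) ∂P) / (n * c ^ 2) ^ 2 := by
  have hsub : {ω | ¬ LipschitzWith c (meanLoss loss (fun i => Z i ω) fun i => ξ i ω)} ⊆
      {ω | (n * (c : ℝ) ^ 2) ^ 2 ≤ L ^ 4 * gramSq fun i => Z i ω} := fun ω hω => by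
    have hlt : n * (c : ℝ) ^ 2 < L ^ 2 * √(gramSq fun i => Z i ω) :=
      not_le.1 fun h => hω (lipschitzWith_meanLoss hloss h _)
    calc (n * (c : ℝ) ^ 2) ^ 2 ≤ (L ^ 2 * √(gramSq fun i => Z i ω)) ^ 2 := by gcongr
      _ = L ^ 4 * gramSq fun i => Z i ω := by
        rw [mul_pow, Real.sq_sqrt (gramSq_nonneg _), ← pow_mul]
  have hmarkov := mul_meas_ge_le_integral_of_nonneg
    (.of_forall fun ω => mul_nonneg (pow_nonneg L.coe_nonneg 4) (gramSq_nonneg fun i => Z i ω))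
    ((integrable_gramSq hZ).const_mul _) ((n * (c : ℝ) ^ 2) ^ 2)
  rw [integral_const_mul] at hmarkov
  rw [le_div_iff₀ (by positivity), mul_comm]
  exact (mul_le_mul_of_nonneg_left (measureReal_mono hsub) (by positivity)).trans hmarkov

theorem measureReal_not_lipschitzWith_meanLoss_le_of_moments {n p d : ℕ} {loss : ℝ → ℝ}
    {L c : ℝ≥0} (hloss : LipschitzWith L loss) (hn : 0 < n) (hc : 0 < c)
    {Z : Fin n → Ω → EuclideanSpace ℝ (Fin p)} {T : Matrix (Fin p) (Fin p) ℝ} {C : ℝ}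
    (hind : iIndepFun Z P) (hZ : ∀ i, HasSecondFourthMoments (Z i) T (C / n ^ 2) P)
    (hT : ∀ j, {l | T j l ≠ 0}.ncard ≤ d) (ξ : Fin n → Ω → ℝ) :
    P.real {ω | ¬ LipschitzWith c (meanLoss loss (fun i => Z i ω) fun i => ξ i ω)} ≤
      C * (L : ℝ) ^ 4 / (c : ℝ) ^ 4 * (((p : ℝ) / n * d + ((p : ℝ) / n) ^ 2) / n) := by
  have hgram := integral_gramSq_le hind hZ
  have hsparse := (hZ ⟨0, hn⟩).sum_sq_apply_le hT
  simp only [Fintype.card_fin] at hgram hsparse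
  have : (0 : ℝ) < n := by exact_mod_cast hn
  calc P.real {ω | ¬ LipschitzWith c (meanLoss loss (fun i => Z i ω) fun i => ξ i ω)}
      ≤ L ^ 4 * (∫ ω, gramSq (fun i => Z i ω) ∂P) / (n * c ^ 2) ^ 2 :=
        measureReal_not_lipschitzWith_meanLoss_le hloss hn hc (fun i => (hZ i).memLp) ξ
    _ ≤ L ^ 4 * (n ^ 2 * (p * (d * (C / n ^ 2))) + n * (p ^ 2 * (C / n ^ 2))) /
          (n * c ^ 2) ^ 2 := by
        gcongr
        exact hgram.trans (by gcongr)
    _ = C * (L : ℝ) ^ 4 / (c : ℝ) ^ 4 * (((p : ℝ) / n * d + ((p : ℝ) / n) ^ 2) / n) := by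
        have : (0 : ℝ) < c := hc
        field_simp

end Concentration

section Rate

theorem four_le_two_mul_ceil {k ε : ℝ} (hε₀ : 0 < ε) (hε₁ : ε ≤ 1 / 4) (hk : 3 / (2 * ε) < k) :
    4 ≤ 2 * ⌈k / 2⌉₊ := by
  have hk' : 3 < k * (2 * ε) := (div_lt_iff₀ (by positivity)).1 hk
  have h : 1 < ⌈k / 2⌉₊ := Nat.lt_ceil.2 (by push_cast; nlinarith)
  omega

theorem mul_add_sq_div_le_rpow {n d : ℕ} {r τ ε : ℝ} (hn : 1 ≤ n) (hτ : 0 < τ) (hr₀ : 0 ≤ r)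
    (hr : r ≤ 1 / τ) (hε₀ : 0 < ε) (hε₁ : ε ≤ 1 / 4) (hd : (d : ℝ) ≤ (n : ℝ) ^ (1 / 4 - ε)) :
    (r * d + r ^ 2) / n ≤ (1 / τ + (1 / τ) ^ 2) * (n : ℝ) ^ (-(1 / 45) : ℝ) := by
  have hn' : (1 : ℝ) ≤ n := by exact_mod_cast hn
  have hone : 1 ≤ (n : ℝ) ^ (1 / 4 - ε) := Real.one_le_rpow hn' (by linarith)
  calc (r * d + r ^ 2) / n
      ≤ (1 / τ * (n : ℝ) ^ (1 / 4 - ε) + (1 / τ) ^ 2 * (n : ℝ) ^ (1 / 4 - ε)) / n := by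
        gcongr
        exact (pow_le_pow_left₀ hr₀ hr 2).trans (le_mul_of_one_le_right (by positivity) hone)
    _ = (1 / τ + (1 / τ) ^ 2) * (n : ℝ) ^ (1 / 4 - ε - 1) := by
        rw [Real.rpow_sub_one (by positivity)]
        ring
    _ ≤ (1 / τ + (1 / τ) ^ 2) * (n : ℝ) ^ (-(1 / 45) : ℝ) := by
        gcongr
        linarith

theorem inv_sq_le_one_add_rpow_add_zpow {ρ t k : ℝ} (hρ : 0 < ρ) (ht : 0 ≤ t) :
    (ρ ^ 2)⁻¹ ≤ 1 + t ^ k + ρ ^ (-3 : ℤ) := by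
  have h := pow_le_one_add_pow (inv_nonneg.2 hρ.le) (by norm_num : 2 ≤ 3)
  rw [zpow_neg, ← inv_pow, ← inv_zpow]
  norm_cast
  linarith [Real.rpow_nonneg ht k]

theorem gap_bound_le_rate {n d : ℕ} {r τ ε c L lam ρ t k : ℝ} (hn : 1 ≤ n) (hτ : 0 < τ)
    (hr₀ : 0 ≤ r) (hr : r ≤ 1 / τ) (hε₀ : 0 < ε) (hε₁ : ε ≤ 1 / 4)
    (hd : (d : ℝ) ≤ (n : ℝ) ^ (1 / 4 - ε)) (hc : 0 ≤ c) (hρ : 0 < ρ) (ht : 0 ≤ t) :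
    c * L ^ 4 / (lam * ρ) ^ 2 * ((r * d + r ^ 2) / n) ≤
      c * L ^ 4 / lam ^ 2 * (1 / τ + (1 / τ) ^ 2) * (1 + t ^ k + ρ ^ (-3 : ℤ)) *
        (n : ℝ) ^ (-(1 / 45) : ℝ) := by
  calc c * L ^ 4 / (lam * ρ) ^ 2 * ((r * d + r ^ 2) / n)
      = c * L ^ 4 / lam ^ 2 * (ρ ^ 2)⁻¹ * ((r * d + r ^ 2) / n) := by ring
    _ ≤ c * L ^ 4 / lam ^ 2 * (1 + t ^ k + ρ ^ (-3 : ℤ)) *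
          ((1 / τ + (1 / τ) ^ 2) * (n : ℝ) ^ (-(1 / 45) : ℝ)) := by
        have hdecay := mul_add_sq_div_le_rpow hn hτ hr₀ hr hε₀ hε₁ hd
        have hinv := inv_sq_le_one_add_rpow_add_zpow (k := k) hρ ht
        gcongr
    _ = _ := by ring

theorem eventually_natCast_le_rpow {d : ℕ → ℕ} {a : ℝ}
    (hd : (fun n => (d n : ℝ)) =o[atTop] fun n : ℕ => (n : ℝ) ^ a) :
    ∀ᶠ n : ℕ in atTop, (d n : ℝ) ≤ (n : ℝ) ^ a := by
  filter_upwards [hd.bound one_pos] with n hn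
  rwa [one_mul, Real.norm_natCast,
    Real.norm_of_nonneg (Real.rpow_nonneg n.cast_nonneg _)] at hn

end Rate

section Estimator

variable {Ω : Type*} [MeasurableSpace Ω] {P : Measure Ω} [IsProbabilityMeasure P] {n p : ℕ}
  {loss : ℝ → ℝ} {L c : ℝ≥0} {lam z ρ εn b : ℝ} {θ₀ : EuclideanSpace ℝ (Fin p)}
  {S : Set (EuclideanSpace ℝ (Fin p))}

theorem two_mul_lt_of_gap {x : Fin n → EuclideanSpace ℝ (Fin p)} {ξ : Fin n → ℝ}
    (hf : LipschitzWith c (meanLoss loss x ξ)) (hlam : 0 < lam) (hc : 5 * (c : ℝ) ^ 2 ≤ lam * ρ)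
    (hmin : minRobustCost loss lam θ₀ Set.univ x ξ < ((z + ρ : ℝ) : EReal))
    (hgap : ((z + 2 * ρ : ℝ) : EReal) < minRobustCost loss lam θ₀ S x ξ)
    {w : EuclideanSpace ℝ (Fin p)} (hw : w ∈ S) : 2 * (c : ℝ) < lam * ‖w + θ₀‖ := by
  by_contra! hnear
  obtain ⟨v, hv⟩ := iInf_lt_iff.1 hmin
  obtain ⟨-, hv⟩ := iInf_lt_iff.1 hv
  have hwS := hgap.trans_le (iInf₂_le w hw)
  rw [EReal.coe_lt_coe_iff] at hv hwS
  have hsub : lam * (robustCost loss lam θ₀ x ξ w - robustCost loss lam θ₀ x ξ v) ≤ lam * ρ :=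
    (penalized_sub_le hf hlam.le hnear).trans hc
  linarith [le_of_mul_le_mul_left hsub hlam]

theorem exists_notMem_of_measureReal_lt_one {A B C : Set Ω}
    (h : P.real A + P.real B + P.real C < 1) : ∃ ω, ω ∉ A ∧ ω ∉ B ∧ ω ∉ C := by
  by_contra! hcover
  have huniv : A ∪ B ∪ C = Set.univ := Set.eq_univ_of_forall fun ω => by
    simp only [Set.mem_union]
    tauto
  have hle := (measureReal_union_le (μ := P) (A ∪ B) C).trans
    (add_le_add_left (measureReal_union_le A B) _)
  rw [huniv, probReal_univ] at hle
  exact hle.not_gt h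

theorem measureReal_minimizer_mem_le {x g : Fin n → Ω → EuclideanSpace ℝ (Fin p)}
    {ξ : Fin n → Ω → ℝ} {ŵ : Ω → EuclideanSpace ℝ (Fin p)} (hlam : 0 < lam)
    (hc : 5 * (c : ℝ) ^ 2 ≤ lam * ρ)
    (hŵ : ∀ᵐ ω ∂P, IsMinOn (robustCost loss lam θ₀ (fun i => x i ω) (fun i => ξ i ω)) Set.univ
      (ŵ ω))
    (hgap : max
      (P.real {ω | ((z + ρ : ℝ) : EReal) ≤
        minRobustCost loss lam θ₀ Set.univ (fun i => g i ω) (fun i => ξ i ω)})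
      (P.real {ω | minRobustCost loss lam θ₀ S (fun i => g i ω) (fun i => ξ i ω) ≤
        ((z + 2 * ρ : ℝ) : EReal)}) ≤ εn)
    (hx : P.real {ω | ¬ LipschitzWith c (meanLoss loss (fun i => x i ω) fun i => ξ i ω)} ≤ b)
    (hg : P.real {ω | ¬ LipschitzWith c (meanLoss loss (fun i => g i ω) fun i => ξ i ω)} ≤ b) :
    P.real {ω | ŵ ω ∈ S} ≤ 2 * εn + b := by
  obtain ⟨hmin, hS⟩ := max_le_iff.1 hgap
  rcases le_or_gt 1 (2 * εn + b) with hlarge | hsmall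
  · exact measureReal_le_one.trans hlarge
  obtain ⟨ω₀, hlip, hmin₀, hS₀⟩ := exists_notMem_of_measureReal_lt_one
    ((add_le_add (add_le_add hg hmin) hS).trans_lt (by linarith))
  simp only [Set.mem_ofPred_eq, not_not, not_le] at hlip hmin₀ hS₀
  -- `S` is not random, so a single good sample of the Gaussian design separates it from `-θ₀`.
  have havoid : ∀ w ∈ S, 2 * (c : ℝ) < lam * ‖w + θ₀‖ := fun w =>
    two_mul_lt_of_gap hlip hlam hc hmin₀ hS₀
  have hbad : {ω | ŵ ω ∈ S} ≤ᵐ[P]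
      {ω | ¬ LipschitzWith c (meanLoss loss (fun i => x i ω) fun i => ξ i ω)} := by
    filter_upwards [hŵ] with ω hω hmem hlip
    have hle : meanLoss loss (fun i => x i ω) (fun i => ξ i ω) (ŵ ω) + lam / 2 * ‖ŵ ω + θ₀‖ ^ 2 ≤
        meanLoss loss (fun i => x i ω) (fun i => ξ i ω) (-θ₀) := by
      simpa [robustCost, meanLoss] using hω (Set.mem_univ (-θ₀))
    exact (havoid _ hmem).not_ge (norm_add_le_of_penalized_le hlip hle)
  have hεn : 0 ≤ εn := measureReal_nonneg.trans hmin
  calc P.real {ω | ŵ ω ∈ S}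
      ≤ P.real {ω | ¬ LipschitzWith c (meanLoss loss (fun i => x i ω) fun i => ξ i ω)} :=
        ENNReal.toReal_mono (measure_ne_top P _) (measure_mono_ae hbad)
    _ ≤ 2 * εn + b := by linarith

theorem measureReal_minimizer_mem_le_of_moments {d : ℕ} {C : ℝ}
    {X G : Fin n → Ω → EuclideanSpace ℝ (Fin p)} {T : Matrix (Fin p) (Fin p) ℝ}
    {ξ : Fin n → Ω → ℝ} {ŵ : Ω → EuclideanSpace ℝ (Fin p)}
    (hn : 0 < n) (hlam : 0 < lam) (hρ : 0 < ρ) (hloss : LipschitzWith L loss)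
    (hXind : iIndepFun X P) (hX : ∀ i, HasSecondFourthMoments (X i) T (C / n ^ 2) P)
    (hGind : iIndepFun G P) (hG : ∀ i, HasSecondFourthMoments (G i) T (C / n ^ 2) P)
    (hT : ∀ j, {l | T j l ≠ 0}.ncard ≤ d)
    (hŵ : ∀ᵐ ω ∂P, IsMinOn (robustCost loss lam θ₀ (fun i => X i ω) (fun i => ξ i ω)) Set.univ
      (ŵ ω))
    (hgap : max
      (P.real {ω | ((z + ρ : ℝ) : EReal) ≤
        minRobustCost loss lam θ₀ Set.univ (fun i => G i ω) (fun i => ξ i ω)})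
      (P.real {ω | minRobustCost loss lam θ₀ S (fun i => G i ω) (fun i => ξ i ω) ≤
        ((z + 2 * ρ : ℝ) : EReal)}) ≤ εn) :
    P.real {ω | ŵ ω ∈ S} ≤ 2 * εn + 25 * C * (L : ℝ) ^ 4 / (lam * ρ) ^ 2 *
      (((p : ℝ) / n * d + ((p : ℝ) / n) ^ 2) / n) := by
  set c : ℝ≥0 := (√(lam * ρ / 5)).toNNReal with hc
  have hcpos : 0 < c := Real.toNNReal_pos.2 (by positivity)
  have hcsq : (c : ℝ) ^ 2 = lam * ρ / 5 := by
    rw [hc, Real.coe_toNNReal _ (Real.sqrt_nonneg _), Real.sq_sqrt (by positivity)]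
  have hconst : 25 * C * (L : ℝ) ^ 4 / (lam * ρ) ^ 2 = C * (L : ℝ) ^ 4 / (c : ℝ) ^ 4 := by
    rw [show (c : ℝ) ^ 4 = (c ^ 2) ^ 2 by ring, hcsq]
    field_simp
    ring
  rw [hconst]
  exact measureReal_minimizer_mem_le hlam (by rw [hcsq]; linarith) hŵ hgap
    (measureReal_not_lipschitzWith_meanLoss_le_of_moments hloss hn hcpos hXind hX hT ξ)
    (measureReal_not_lipschitzWith_meanLoss_le_of_moments hloss hn hcpos hGind hG hT ξ)

theorem theorem3_general {M : ℝ} {d m : ℕ} {X G : Fin n → Ω → EuclideanSpace ℝ (Fin p)}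
    {Sig : Matrix (Fin p) (Fin p) ℝ} {ξ : Fin n → Ω → ℝ} {ŵ : Ω → EuclideanSpace ℝ (Fin p)}
    (hn : 0 < n) (hlam : 0 < lam) (hρ : 0 < ρ) (hloss : LipschitzWith L loss)
    (hSig : Sig.PosSemidef) (hXind : iIndepFun X P) (hX : ∀ i, HasMoments (X i) n Sig P)
    (hXblock : ∀ i, IsBlockDependent (X i) d P) (hm : 4 ≤ m)
    (hXM : ∀ i j, Integrable (fun ω => |√(n : ℝ) * X i ω j| ^ m) P ∧
      ∫ ω, |√(n : ℝ) * X i ω j| ^ m ∂P ≤ M)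
    (hGind : iIndepFun G P)
    (hG : ∀ i, HasLaw (G i) (multivariateGaussian 0 ((n : ℝ)⁻¹ • Sig)) P)
    (hŵ : ∀ᵐ ω ∂P, IsMinOn (robustCost loss lam θ₀ (fun i => X i ω) (fun i => ξ i ω)) Set.univ
      (ŵ ω))
    (hgap : max
      (P.real {ω | ((z + ρ : ℝ) : EReal) ≤
        minRobustCost loss lam θ₀ Set.univ (fun i => G i ω) (fun i => ξ i ω)})
      (P.real {ω | minRobustCost loss lam θ₀ S (fun i => G i ω) (fun i => ξ i ω) ≤
        ((z + 2 * ρ : ℝ) : EReal)}) ≤ εn) :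
    P.real {ω | ŵ ω ∈ S} ≤ 2 * εn + 25 * (3 * (1 + |M|)) * (L : ℝ) ^ 4 / (lam * ρ) ^ 2 *
      (((p : ℝ) / n * d + ((p : ℝ) / n) ^ 2) / n) := by
  have hX₄ : ∀ i, HasSecondFourthMoments (X i) ((n : ℝ)⁻¹ • Sig) ((1 + |M|) / n ^ 2) P := fun i =>
    (hX i).hasSecondFourthMoments hn hm fun j => (hXM i j).imp_right (le_trans · (le_abs_self M))
  have hG₄ : ∀ i, HasSecondFourthMoments (G i) ((n : ℝ)⁻¹ • Sig) (3 * (1 + |M|) / n ^ 2) P :=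
    fun i => mul_div_assoc 3 (1 + |M|) _ ▸
      (hX₄ i).of_hasLaw_multivariateGaussian (hSig.smul (by positivity)) (hG i)
  exact measureReal_minimizer_mem_le_of_moments hn hlam hρ hloss hXind
    (fun i => (hX₄ i).mono (by gcongr; linarith [abs_nonneg M])) hGind hG₄
    ((hXblock ⟨0, hn⟩).ncard_ne_zero_le (hX _)) hŵ hgap

end Estimator

theorem theorem3 (lam τ M k ε L₀ : ℝ) (hlam : 0 < lam) (hτ₀ : 0 < τ) (hτ₁ : τ < 1)
    (hL₀ : 0 < L₀) (hε₀ : 0 < ε) (hε₁ : ε ≤ 1 / 4) (hk : 3 / (2 * ε) < k) :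
    -- the constant depends on `lam, τ, M, k, ε, L₀` only
    ∃ K : ℝ, 0 < K ∧
      ∀ d : ℕ → ℕ, (fun n => (d n : ℝ)) =o[atTop] (fun n : ℕ => (n : ℝ) ^ (1 / 4 - ε)) →
      ∀ᶠ n : ℕ in atTop, ∀ p : ℕ, τ ≤ (p : ℝ) / n → (p : ℝ) / n ≤ 1 / τ →
      -- loss, true parameter, covariance matrix
      ∀ (loss : ℝ → ℝ), IsRobustLoss loss L₀ →
      ∀ (θ₀ : EuclideanSpace ℝ (Fin p)) (Sig : Matrix (Fin p) (Fin p) ℝ), Sig.PosDef →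
      ∀ (Ω : Type*) [MeasurableSpace Ω] (P : Measure Ω) [IsProbabilityMeasure P]
        (X G : Fin n → Ω → EuclideanSpace ℝ (Fin p)) (ξ : Fin n → Ω → ℝ),
      -- covariates
      IsIID X P → (∀ i, HasMoments (X i) n Sig P) → (∀ i, IsBlockDependent (X i) (d n) P) →
      (∀ i j, Integrable (fun ω => |√(n : ℝ) * X i ω j| ^ (2 * ⌈k / 2⌉₊)) P ∧
        ∫ ω, |√(n : ℝ) * X i ω j| ^ (2 * ⌈k / 2⌉₊) ∂P ≤ M) →
      -- Gaussian covariates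
      IsIID G P → (∀ i, HasLaw (G i) (multivariateGaussian 0 ((n : ℝ)⁻¹ • Sig)) P) →
      -- noise, independent of the covariates
      IsIID ξ P → IndepFun (fun ω i => X i ω) (fun ω i => ξ i ω) P →
      IndepFun (fun ω i => G i ω) (fun ω i => ξ i ω) P →
      -- the estimator: the minimizer of the cost under the covariates `X`
      ∀ ŵ : Ω → EuclideanSpace ℝ (Fin p),
      (∀ᵐ ω ∂P, IsMinOn (robustCost loss lam θ₀ (fun i => X i ω) (fun i => ξ i ω)) Set.univ
        (ŵ ω)) →
      -- the exceptional set and the gap condition for the Gaussian cost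
      ∀ S : Set (EuclideanSpace ℝ (Fin p)), MeasurableSet S →
      ∀ z ρ₀ εn : ℝ, 0 < ρ₀ → 0 ≤ εn → εn < 1 / 4 →
      max
        (P.real {ω | ((z + ρ₀ : ℝ) : EReal) ≤
          minRobustCost loss lam θ₀ Set.univ (fun i => G i ω) (fun i => ξ i ω)})
        (P.real {ω | minRobustCost loss lam θ₀ S (fun i => G i ω) (fun i => ξ i ω) ≤
          ((z + 2 * ρ₀ : ℝ) : EReal)}) ≤ εn →
      P.real {ω | ŵ ω ∈ S} ≤
        4 * εn + K * (1 + ‖WithLp.ofLp θ₀‖ ^ k + ρ₀ ^ (-3 : ℤ)) * (n : ℝ) ^ (-(1 / 45) : ℝ) := by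
  refine ⟨25 * (3 * (1 + |M|)) * L₀ ^ 4 / lam ^ 2 * (1 / τ + (1 / τ) ^ 2), by positivity,
    fun d hd => ?_⟩
  filter_upwards [eventually_natCast_le_rpow hd, eventually_ge_atTop 1] with n hdn hn p _ hp loss
    hloss θ₀ Sig hSig Ω _ P _ X G ξ hX hXmom hXblock hXM hG hGlaw _ _ _ ŵ hŵ S _ z ρ₀ εn hρ₀ hεn _
    hgap
  have hmain := theorem3_general hn hlam hρ₀ hloss.lipschitzWith hSig.posSemidef hX.2.1 hXmom
    hXblock (four_le_two_mul_ceil hε₀ hε₁ hk) hXM hG.2.1 hGlaw hŵ hgap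
  rw [Real.coe_toNNReal _ hL₀.le] at hmain
  linarith [gap_bound_le_rate (c := 25 * (3 * (1 + |M|))) (L := L₀) (lam := lam) (k := k) hn hτ₀
    (by positivity) hp hε₀ hε₁ hdn (by positivity) hρ₀ (norm_nonneg (WithLp.ofLp θ₀))]
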